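/- Let $G=(V,E)$ be a finite connected simple undirected graph with at least two vertices, $N(v)$ the neighbors of $v$ and $k_v=|N(v)|$. For every $v$ let a partition $g(N(v))=\{S_1,\dots,S_m\}$ of $N(v)$ into nonempty groups be given (an arbitrary grouping function). Simple random walk (SRW) moves from $v$ to a uniformly random neighbor of $v$. The GroupBy Neighbors Random Walk (GNRW) starts with an arbitrary (possibly random) transition $X_0\to X_1$ along an edge and keeps, for every directed edge $u\to v$, a set $b(u,v)\subseteq N(v)$ of attempted neighbors and a set $S(u,v)$ of accessed groups of $N(v)$, all initially empty. After each transition $u\to v$: 1. It chooses a group $S_i\notin S(u,v)$ with $S_i\setminus b(u,v)\neq\emptyset$, with probability proportional to the weight of $S_i$, where the weight of a group is its size $|S_i|$ (or, in a second version of the walk, the number $|S_i\setminus b(u,v)|$ of its neighbors not yet attempted). 2. It moves to a uniformly random node $w\in S_i\setminus b(u,v)$. 3. It adds $w$ to $b(u,v)$ and $S_i$ to $S(u,v)$; if now $b(u,v)=N(v)$, then $b(u,v)$ is reset to $\emptyset$; after that, if $S(u,v)$ contains every group that still has a neighbor outside $b(u,v)$, then $S(u,v)$ is reset to $\emptyset$.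 Then, for both versions of GNRW and for any initial distributions: (a) GNRW has the same stationary distribution as SRW, $\pi(v)=k_v/(2|E|)$: if $(X_t)$ is either walk, then for every $v\in V$ $$\lim_{n\to\infty}\frac1n\sum_{m=1}^n\Pr\{X_m=v\}=\frac{k_v}{2|E|}.$$ (b) For every $f:V\to\mathbb R$, with the estimators $\hat\mu_n=\frac1n\sum_{t=1}^n f(X_t)$ from SRW and $\hat\mu^*_n=\frac1n\sum_{t=1}^n f(X^*_t)$ from GNRW, the asymptotic variances $V_\infty(\hat\mu)=\lim_{n\to\infty} n\operatorname{Var}(\hat\mu_n)$ and $V_\infty(\hat\mu^*)=\lim_{n\to\infty} n\operatorname{Var}(\hat\mu^*_n)$ exist, do not depend on the initial distributions, and satisfy $V_\infty(\hat\mu^*)\le V_\infty(\hat\mu)$. -/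

import Mathlib

open Filter Topology MeasureTheory ProbabilityTheory

/-- `p` is the family of conditional distributions of the process `X` from time `s + 1` on:
for every `n ≥ s` and every sequence of nodes `x`,
`Pr(X₀ = x₀, …, Xₙ₊₁ = xₙ₊₁) = Pr(X₀ = x₀, …, Xₙ = xₙ) * p n x xₙ₊₁`.
(`p n x w` is meant to depend on `x₀, …, xₙ` and `w` only.) -/
def HasTransitionsFrom {V Ω : Type*} [MeasurableSpace Ω] (P : Measure Ω) (X : ℕ → Ω → V)
    (s : ℕ) (p : ℕ → (ℕ → V) → V → ℝ) : Prop :=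
  ∀ (n : ℕ) (x : ℕ → V), s ≤ n →
    P.real {ω | ∀ i ≤ n + 1, X i ω = x i} =
      P.real {ω | ∀ i ≤ n, X i ω = x i} * p n x (x (n + 1))

/-- The one-step probabilities of simple random walk: uniform on the neighbors. -/
noncomputable def srwProb {V : Type*} [Fintype V] (G : SimpleGraph V) [DecidableRel G.Adj]
    (v w : V) : ℝ :=
  if G.Adj v w then 1 / (G.degree v : ℝ) else 0

/-- `X₀, X₁, …` is a simple random walk on `G`, with an arbitrary initial distribution. -/
structure IsSRW {V Ω : Type*} [Fintype V] [MeasurableSpace Ω]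
    (G : SimpleGraph V) [DecidableRel G.Adj] (P : Measure Ω) (X : ℕ → Ω → V) : Prop where
  measurableSet_eq : ∀ n v, MeasurableSet {ω | X n ω = v}
  transitions : HasTransitionsFrom P X 0 (fun n x w => srwProb G (x n) w)

/-- The two ways of weighting the groups: by the size of the group, or by the number of its
nodes that have not yet been attempted. -/
inductive GroupWeight
  | size
  | unattempted

/-- The memory of the walk. For each directed edge `u → v`: the set `b(u,v)` of neighbors of `v`
already attempted after `u → v`, and the set `S(u,v)` of groups of neighbors of `v` already
accessed after `u → v`, in the current circulations. -/
structure GNRWMemory (V : Type*) where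
  attempted : V → V → Finset V
  accessed : V → V → Finset (Finset V)

namespace GNRWMemory

variable {V : Type*}

/-- Nothing has been attempted or accessed. -/
def init : GNRWMemory V where
  attempted := fun _ _ => ∅
  accessed := fun _ _ => ∅

variable [DecidableEq V]

/-- The neighbors of `v` in the group `A` that are still to be attempted after `u → v`. -/
def remaining (M : GNRWMemory V) (u v : V) (A : Finset V) : Finset V :=
  A \ M.attempted u v

/-- The weight of the group `A` of neighbors of `v`, when the walk comes from `u`. -/
def weight (r : GroupWeight) (M : GNRWMemory V) (u v : V) (A : Finset V) : ℕ :=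
  match r with
  | .size => A.card
  | .unattempted => (M.remaining u v A).card

variable [Fintype V] {G : SimpleGraph V} [DecidableRel G.Adj]

/-- The groups that may be chosen next after `u → v`: those not accessed in the current
circulation of the groups in which some node is left to be attempted. -/
def candidates (g : ∀ v, Finpartition (G.neighborFinset v)) (M : GNRWMemory V) (u v : V) :
    Finset (Finset V) :=
  (g v).parts.filter fun A => A ∉ M.accessed u v ∧ (M.remaining u v A).Nonempty

/-- The probability that the next node after `u → v` is `w`: a candidate group `A` is chosen with
probability proportional to its weight, then a node of `A` still to be attempted is chosen
uniformly at random. -/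
noncomputable def nextProb (r : GroupWeight) (g : ∀ v, Finpartition (G.neighborFinset v))
    (M : GNRWMemory V) (u v w : V) : ℝ :=
  ∑ A ∈ M.candidates g u v,
    ((M.weight r u v A : ℝ) / ∑ B ∈ M.candidates g u v, (M.weight r u v B : ℝ)) *
      (if w ∈ M.remaining u v A then 1 / ((M.remaining u v A).card : ℝ) else 0)

/-- `b(u,v)` after the transition `u → v → w`: add `w`, and start afresh once all neighbors of `v`
have been attempted. -/
def newAttempted (G : SimpleGraph V) [DecidableRel G.Adj] (M : GNRWMemory V) (u v w : V) :
    Finset V :=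
  if insert w (M.attempted u v) = G.neighborFinset v then ∅ else insert w (M.attempted u v)

/-- `S(u,v)` after the transition `u → v → w`: add the group of `w`, and start afresh once all
groups in which some node is left to be attempted have been accessed. -/
def newAccessed (g : ∀ v, Finpartition (G.neighborFinset v)) (M : GNRWMemory V) (u v w : V) :
    Finset (Finset V) :=
  if ∀ A ∈ (g v).parts, (A \ M.newAttempted G u v w).Nonempty →
      A ∈ insert ((g v).part w) (M.accessed u v)
  then ∅ else insert ((g v).part w) (M.accessed u v)

/-- The memory after the transition `u → v → w`; only the entry of the edge `u → v` changes. -/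
def update (g : ∀ v, Finpartition (G.neighborFinset v)) (M : GNRWMemory V) (u v w : V) :
    GNRWMemory V where
  attempted := fun u' v' =>
    if u' = u ∧ v' = v then M.newAttempted G u v w else M.attempted u' v'
  accessed := fun u' v' =>
    if u' = u ∧ v' = v then M.newAccessed g u v w else M.accessed u' v'

/-- The memory of a walk that has followed `x 0, x 1, …, x (k + 1)`. -/
def along (g : ∀ v, Finpartition (G.neighborFinset v)) (x : ℕ → V) : ℕ → GNRWMemory V
  | 0 => init
  | k + 1 => (along g x k).update g (x k) (x (k + 1)) (x (k + 2))

end GNRWMemory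

/-- `X₀, X₁, …` is a GroupBy Neighbors Random Walk on `G` for the grouping `g`, started from an
arbitrary (possibly random) first transition `X₀ → X₁` along an edge. -/
structure IsGNRW {V Ω : Type*} [Fintype V] [DecidableEq V] [MeasurableSpace Ω]
    (G : SimpleGraph V) [DecidableRel G.Adj] (r : GroupWeight)
    (g : ∀ v, Finpartition (G.neighborFinset v)) (P : Measure Ω) (X : ℕ → Ω → V) : Prop where
  measurableSet_eq : ∀ n v, MeasurableSet {ω | X n ω = v}
  adj_start : ∀ᵐ ω ∂P, G.Adj (X 0 ω) (X 1 ω)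
  transitions : HasTransitionsFrom P X 1 (fun n x w =>
    (GNRWMemory.along g x (n - 1)).nextProb r g (x (n - 1)) (x n) w)

/-- `π v` is the long run proportion of time that the walk `X` spends on node `v`. -/
def HasStationaryDistribution {V Ω : Type*} [MeasurableSpace Ω] (P : Measure Ω)
    (X : ℕ → Ω → V) (π : V → ℝ) : Prop :=
  ∀ v, Tendsto (fun n : ℕ => (1 / (n : ℝ)) * ∑ m ∈ Finset.Icc 1 n, P.real {ω | X m ω = v})
    atTop (𝓝 (π v))

/-- The estimator `(1/n) ∑_{t=1}^n f(X_t)`. -/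
noncomputable def meanEstimator {V Ω : Type*} (X : ℕ → Ω → V) (f : V → ℝ) (n : ℕ) (ω : Ω) : ℝ :=
  (1 / (n : ℝ)) * ∑ t ∈ Finset.Icc 1 n, f (X t ω)

/-- The limit of `n * Var(μ̂ₙ)` exists and equals `σ`, where `μ̂ₙ` is the mean estimator. -/
def HasAsymptoticVariance {V Ω : Type*} [MeasurableSpace Ω] (P : Measure Ω)
    (X : ℕ → Ω → V) (f : V → ℝ) (σ : ℝ) : Prop :=
  Tendsto (fun n : ℕ => (n : ℝ) * variance (meanEstimator X f n) P) atTop (𝓝 σ)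

/-! Let `A` be the averaging operator of SRW and `π` the degree distribution. On a connected graph
the Poisson equation `h - A h = f - π(f)` has a solution (`exists_sub_srwAverage_eq`). Along any
sequence of nodes, the centered sum of `f` is then a bounded telescoping term plus the sum of the
increments `h (x (t+1)) - A h (x t)` (`sum_sub_degreeMean_eq`).

For SRW the increments are orthogonal with mean zero. Hence the expected centered sums stay bounded,
which gives the Cesàro limits without any mixing or aperiodicity. The second moment of the increment
sum is the sum of the expected one-step variances of `h`, whose Cesàro limit is `σ`.

For GNRW, sort the increments by the directed edge `u → v` just traversed. A complete circulation
takes each neighbor of `v` exactly once, and `h w - A h v` sums to zero over them; only the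
unfinished circulations survive (`GNRWMemory.sum_increments_along`). The centered sums are thus
almost surely uniformly bounded, so `π` is again the limit and `σ' = 0 ≤ σ`. Grouping and weights
enter only through the fact that no node is repeated within a circulation. -/

/-- The averaging operator of simple random walk. -/
noncomputable def srwAverage {V : Type*} [Fintype V] (G : SimpleGraph V) [DecidableRel G.Adj]
    (h : V → ℝ) (v : V) : ℝ :=
  ∑ w, srwProb G v w * h w

/-- The mean of `f` with respect to the distribution proportional to the degree. -/
noncomputable def degreeMean {V : Type*} [Fintype V] (G : SimpleGraph V) [DecidableRel G.Adj]
    (f : V → ℝ) : ℝ :=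
  ∑ v, (G.degree v : ℝ) / (2 * (G.edgeFinset.card : ℝ)) * f v

/-! ### Averaging over neighbors and the Poisson equation -/

section Graph

variable {V : Type*} [Fintype V] (G : SimpleGraph V) [DecidableRel G.Adj]

theorem degree_mul_srwAverage (h : V → ℝ) (v : V) (hv : 0 < G.degree v) :
    (G.degree v : ℝ) * srwAverage G h v = ∑ w ∈ G.neighborFinset v, h w := by
  have hd : (G.degree v : ℝ) ≠ 0 := by positivity
  have hs : ∑ w ∈ G.neighborFinset v, h w = ∑ w, if G.Adj v w then h w else 0 := by
    rw [← Finset.sum_filter]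
    congr 1
    ext w
    simp
  rw [hs, srwAverage, Finset.mul_sum]
  refine Finset.sum_congr rfl fun w _ => ?_
  unfold srwProb
  split_ifs
  · field_simp
  · simp

theorem sum_srwProb (v : V) (hv : 0 < G.degree v) : ∑ w, srwProb G v w = 1 := by
  have h := degree_mul_srwAverage G (fun _ => 1) v hv
  simp only [srwAverage, mul_one, Finset.sum_const, G.card_neighborFinset_eq_degree,
    nsmul_eq_mul] at h
  have hd : (G.degree v : ℝ) ≠ 0 := by positivity
  exact mul_left_cancel₀ hd (by rw [h, mul_one])

theorem srwProb_nonneg (v w : V) : 0 ≤ srwProb G v w := by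
  unfold srwProb
  split_ifs <;> positivity

theorem sum_neighborFinset_sub_srwAverage (h : V → ℝ) (v : V) (hv : 0 < G.degree v) :
    ∑ w ∈ G.neighborFinset v, (h w - srwAverage G h v) = 0 := by
  rw [Finset.sum_sub_distrib, ← degree_mul_srwAverage G h v hv, Finset.sum_const,
    G.card_neighborFinset_eq_degree, nsmul_eq_mul, sub_self]

variable {G}

/-- The Laplacian is symmetric, so its range is the orthogonal complement of its kernel, and
connectivity leaves only the constants in the kernel. -/
theorem exists_lapMatrix_mulVec_eq [DecidableEq V] (hG : G.Connected)
    (c : V → ℝ) (hc : ∑ v, c v = 0) :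
    ∃ h : V → ℝ, (G.lapMatrix ℝ).mulVec h = c := by
  have hsymm : (Matrix.toEuclideanLin (G.lapMatrix ℝ)).IsSymmetric := by
    rw [Matrix.isSymmetric_toEuclideanLin_iff]
    have := G.isSymm_lapMatrix (R := ℝ)
    rw [Matrix.IsHermitian, Matrix.conjTranspose_eq_transpose_of_trivial]
    exact this
  have hmem : WithLp.toLp 2 c ∈ LinearMap.range (Matrix.toEuclideanLin (G.lapMatrix ℝ)) := by
    rw [← Submodule.orthogonal_orthogonal (LinearMap.range _), hsymm.orthogonal_range,
      Submodule.mem_orthogonal]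
    intro u hu
    have hu' : (G.lapMatrix ℝ).mulVec u.ofLp = 0 := by
      have := congrArg WithLp.ofLp (LinearMap.mem_ker.1 hu)
      simpa using this
    have hconst : ∀ i j, u.ofLp i = u.ofLp j := fun i j =>
      (G.lapMatrix_mulVec_eq_zero_iff_forall_reachable).1 hu' i j (hG.preconnected i j)
    obtain ⟨v⟩ := hG.nonempty
    simp only [PiLp.inner_apply]
    have : ∀ i, inner ℝ (u i) (c i) = u v * c i := fun i => by
      rw [show u i = u v from hconst i v]; simp [mul_comm]
    simp only [this]
    rw [← Finset.mul_sum, hc, mul_zero]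
  obtain ⟨h, hh⟩ := hmem
  refine ⟨h.ofLp, ?_⟩
  simpa using congrArg WithLp.ofLp hh

/-- The Poisson equation of simple random walk on a connected graph is solvable. -/
theorem exists_sub_srwAverage_eq [DecidableEq V] [Nontrivial V] (hG : G.Connected) (f : V → ℝ) :
    ∃ h : V → ℝ, ∀ v, h v - srwAverage G h v = f v - degreeMean G f := by
  have hdeg : ∀ v, 0 < G.degree v := fun v => hG.preconnected.degree_pos_of_nontrivial v
  have hs : ∑ v, (G.degree v : ℝ) = 2 * (G.edgeFinset.card : ℝ) := by
    exact_mod_cast G.sum_degrees_eq_twice_card_edges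
  -- Multiplied by the degree, the Poisson equation becomes a Laplacian equation; its right side
  -- sums to zero by the choice of `degreeMean`.
  obtain ⟨h, hh⟩ := exists_lapMatrix_mulVec_eq hG
    (fun v => (G.degree v : ℝ) * (f v - degreeMean G f)) (by
      have hpos : 0 < ∑ v, (G.degree v : ℝ) := Finset.sum_pos
        (fun v _ => by exact_mod_cast hdeg v) Finset.univ_nonempty
      simp only [mul_sub, Finset.sum_sub_distrib, ← Finset.sum_mul]
      rw [degreeMean, ← hs, Finset.mul_sum, ← Finset.sum_sub_distrib]
      refine Finset.sum_eq_zero fun v _ => ?_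
      field_simp
      ring)
  refine ⟨h, fun v => ?_⟩
  have hv := congrFun hh v
  rw [G.lapMatrix_mulVec_apply, ← degree_mul_srwAverage G h v (hdeg v), ← mul_sub] at hv
  exact mul_left_cancel₀ (by exact_mod_cast (hdeg v).ne') hv

/-- A pathwise identity, with no probability in it, so it serves both walks. -/
theorem sum_sub_degreeMean_eq {f h : V → ℝ}
    (hh : ∀ v, h v - srwAverage G h v = f v - degreeMean G f) (x : ℕ → V) (n : ℕ) :
    ∑ t ∈ Finset.Icc 1 n, (f (x t) - degreeMean G f) =
      h (x 1) - h (x (n + 1)) +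
        ∑ t ∈ Finset.Icc 1 n, (h (x (t + 1)) - srwAverage G h (x t)) := by
  induction n with
  | zero => simp
  | succ n ih =>
    rw [Finset.sum_Icc_succ_top (by omega), Finset.sum_Icc_succ_top (by omega), ih, ← hh]
    ring

end Graph

theorem exists_forall_abs_le {V : Type*} [Finite V] (f : V → ℝ) : ∃ C, ∀ v, |f v| ≤ C := by
  obtain ⟨C, hC⟩ := (Set.finite_range fun v => |f v|).bddAbove
  exact ⟨C, fun v => hC ⟨v, rfl⟩⟩

/-- The sequence that follows `y` up to time `n` and is `w` from then on. -/
noncomputable def extendPrefix {V : Type*} {n : ℕ} (y : Fin (n + 1) → V) (w : V) (i : ℕ) : V :=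
  if h : i < n + 1 then y ⟨i, h⟩ else w

theorem extendPrefix_of_le {V : Type*} {n : ℕ} (y : Fin (n + 1) → V) (w : V) {i : ℕ} (hi : i ≤ n) :
    extendPrefix y w i = y ⟨i, Nat.lt_succ_of_le hi⟩ :=
  dif_pos _

theorem extendPrefix_succ {V : Type*} {n : ℕ} (y : Fin (n + 1) → V) (w : V) :
    extendPrefix y w (n + 1) = w :=
  dif_neg (lt_irrefl _)

theorem extendPrefix_prefix_eq {V : Type*} {n : ℕ} (x : ℕ → V) (w : V) {i : ℕ} (hi : i ≤ n) :
    extendPrefix (fun j : Fin (n + 1) => x j) w i = x i :=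
  extendPrefix_of_le _ _ hi

/-! ### Finite prefixes of a random sequence of nodes -/

section RandomSequence

variable {V Ω : Type*} [Fintype V] [MeasurableSpace Ω] {P : Measure Ω} {X : ℕ → Ω → V}

theorem measurable_comp_of_measurableSet_eq (hX : ∀ n v, MeasurableSet {ω | X n ω = v})
    (f : V → ℝ) (n : ℕ) : Measurable fun ω => f (X n ω) := by
  let _ : MeasurableSpace V := ⊤
  have : Measurable (X n) := measurable_to_countable' fun v => hX n v
  exact measurable_from_top.comp this

theorem integrable_comp [IsFiniteMeasure P] (hX : ∀ n v, MeasurableSet {ω | X n ω = v})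
    (f : V → ℝ) (n : ℕ) : Integrable (fun ω => f (X n ω)) P := by
  obtain ⟨C, hC⟩ := exists_forall_abs_le f
  exact Integrable.of_bound
    (measurable_comp_of_measurableSet_eq hX f n).aestronglyMeasurable C
    (Eventually.of_forall fun ω => hC _)

/-- A property of the first steps of a process holds almost surely if every finite sequence that
violates it has probability zero. -/
theorem ae_of_forall_prefix [IsFiniteMeasure P] (n : ℕ) (Q : (ℕ → V) → Prop)
    (hQ : ∀ x y : ℕ → V, (∀ i ≤ n, x i = y i) → Q x → Q y)
    (hP : ∀ x, ¬ Q x → P.real {ω | ∀ i ≤ n, X i ω = x i} = 0) :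
    ∀ᵐ ω ∂P, Q fun i => X i ω := by
  rcases isEmpty_or_nonempty V with hV | ⟨⟨v₀⟩⟩
  · have : IsEmpty Ω := ⟨fun ω => hV.elim (X 0 ω)⟩
    exact Eventually.of_forall fun ω => (this.elim ω)
  -- There are finitely many prefixes, so they can be treated one at a time; `v₀` only fills the
  -- irrelevant later times.
  have h : ∀ y : Fin (n + 1) → V, ∀ᵐ ω ∂P,
      (∀ i ≤ n, X i ω = extendPrefix y v₀ i) → Q fun i => X i ω := by
    intro y
    by_cases hy : Q (extendPrefix y v₀)
    · exact Eventually.of_forall fun ω hω => hQ _ _ (fun i hi => (hω i hi).symm) hy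
    · have h0 := hP _ hy
      rw [measureReal_eq_zero_iff] at h0
      have : ∀ᵐ ω ∂P, ¬ ∀ i ≤ n, X i ω = extendPrefix y v₀ i := by
        rw [ae_iff]
        simpa using h0
      filter_upwards [this] with ω hω hω'
      exact absurd hω' hω
  filter_upwards [ae_all_iff.2 h] with ω hω
  exact hω (fun j => X j ω) fun i hi => (extendPrefix_prefix_eq (fun j => X j ω) v₀ hi).symm

/-- The Markov property of simple random walk in integrated form. -/
theorem IsSRW.integral_mul_next {G : SimpleGraph V} [DecidableRel G.Adj] [IsFiniteMeasure P]
    (hX : IsSRW G P X) (n : ℕ) (F : (ℕ → V) → ℝ)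
    (hF : ∀ x y : ℕ → V, (∀ i ≤ n, x i = y i) → F x = F y) (k : V → V → ℝ) :
    ∫ ω, F (fun i => X i ω) * k (X n ω) (X (n + 1) ω) ∂P =
      ∫ ω, F (fun i => X i ω) * ∑ w, srwProb G (X n ω) w * k (X n ω) w ∂P := by
  rcases isEmpty_or_nonempty V with hV | ⟨⟨v₀⟩⟩
  · have : IsEmpty Ω := ⟨fun ω => hV.elim (X 0 ω)⟩
    simp [Measure.eq_zero_of_isEmpty P]
  let _ : MeasurableSpace V := ⊤
  have _ : DiscreteMeasurableSpace V := ⟨fun _ => trivial⟩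
  have hm : ∀ i, Measurable (X i) := fun i => measurable_to_countable' fun v =>
    hX.measurableSet_eq i v
  let T : Ω → Fin (n + 1) → V := fun ω i => X i ω
  have hT : Measurable T := measurable_pi_lambda _ fun i => hm i
  have hTF : ∀ ω, F (fun i => X i ω) = F (extendPrefix (T ω) v₀) := fun ω =>
    hF _ _ fun i hi => (extendPrefix_prefix_eq (fun j => X j ω) v₀ hi).symm
  have hprefix : ∀ y w, {ω | T ω = y} = {ω | ∀ i ≤ n, X i ω = extendPrefix y w i} := by
    intro y w
    ext ω
    constructor
    · rintro rfl i hi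
      exact (extendPrefix_prefix_eq (fun j => X j ω) w hi).symm
    · intro hω
      funext i
      have := hω i (Nat.le_of_lt_succ i.2)
      rwa [extendPrefix_of_le _ _ (Nat.le_of_lt_succ i.2)] at this
  -- The joint law of the prefix and the next node; both integrals become finite sums against it.
  have hpair : ∀ y w, P.real {ω | (T ω, X (n + 1) ω) = (y, w)} =
      P.real {ω | T ω = y} * srwProb G (y (Fin.last n)) w := by
    intro y w
    have := hX.transitions n (extendPrefix y w) (Nat.zero_le n)
    beta_reduce at this
    rw [extendPrefix_succ, extendPrefix_of_le _ _ le_rfl, ← hprefix] at this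
    rw [show y (Fin.last n) = y ⟨n, Nat.lt_succ_of_le le_rfl⟩ from rfl, ← this]
    congr 1
    ext ω
    have h1 : T ω = y ↔ ∀ i ≤ n, X i ω = extendPrefix y w i := by
      have := hprefix y w
      exact Set.ext_iff.1 this ω
    simp only [Set.mem_ofPred_eq, Prod.mk.injEq, h1]
    constructor
    · rintro ⟨ha, hb⟩ i hi
      rcases Nat.lt_or_ge n i with hni | hni
      · obtain rfl : i = n + 1 := by omega
        rw [hb, extendPrefix_succ]
      · exact ha i hni
    · intro ha
      exact ⟨fun i hi => ha i (by omega), by rw [ha (n + 1) le_rfl, extendPrefix_succ]⟩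
  have hpairm : Measurable fun ω => (T ω, X (n + 1) ω) := hT.prodMk (hm _)
  have hL : ∫ ω, F (fun i => X i ω) * k (X n ω) (X (n + 1) ω) ∂P =
      ∑ y : Fin (n + 1) → V, ∑ w, P.real {ω | (T ω, X (n + 1) ω) = (y, w)} *
        (F (extendPrefix y v₀) * k (y (Fin.last n)) w) := by
    have : ∫ ω, F (fun i => X i ω) * k (X n ω) (X (n + 1) ω) ∂P =
        ∫ z, F (extendPrefix z.1 v₀) * k (z.1 (Fin.last n)) z.2
          ∂(P.map fun ω => (T ω, X (n + 1) ω)) := by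
      rw [integral_map hpairm.aemeasurable (measurable_of_finite _).aestronglyMeasurable]
      exact integral_congr_ae (Eventually.of_forall fun ω => by
        simp only [hTF ω]; rfl)
    rw [this, integral_fintype (Integrable.of_finite), Fintype.sum_prod_type]
    refine Finset.sum_congr rfl fun y _ => Finset.sum_congr rfl fun w _ => ?_
    rw [map_measureReal_apply hpairm (measurableSet_singleton _), smul_eq_mul]
    rfl
  have hR : ∫ ω, F (fun i => X i ω) * ∑ w, srwProb G (X n ω) w * k (X n ω) w ∂P =
      ∑ y : Fin (n + 1) → V, P.real {ω | T ω = y} *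
        (F (extendPrefix y v₀) *
          ∑ w, srwProb G (y (Fin.last n)) w * k (y (Fin.last n)) w) := by
    have : ∫ ω, F (fun i => X i ω) * ∑ w, srwProb G (X n ω) w * k (X n ω) w ∂P =
        ∫ z, F (extendPrefix z v₀) *
          ∑ w, srwProb G (z (Fin.last n)) w * k (z (Fin.last n)) w ∂(P.map T) := by
      rw [integral_map hT.aemeasurable (measurable_of_finite _).aestronglyMeasurable]
      exact integral_congr_ae (Eventually.of_forall fun ω => by
        simp only [hTF ω]; rfl)
    rw [this, integral_fintype (Integrable.of_finite)]
    refine Finset.sum_congr rfl fun y _ => ?_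
    rw [map_measureReal_apply hT (measurableSet_singleton _), smul_eq_mul]
    rfl
  rw [hL, hR]
  refine Finset.sum_congr rfl fun y _ => ?_
  rw [Finset.mul_sum, Finset.mul_sum]
  refine Finset.sum_congr rfl fun w _ => ?_
  rw [hpair]
  ring

end RandomSequence

/-! ### Long-run averages and variances of the two walks -/

section Walks

variable {V Ω : Type*} [Fintype V] [MeasurableSpace Ω]
  {G : SimpleGraph V} [DecidableRel G.Adj] {P : Measure Ω} [IsProbabilityMeasure P]
  {X : ℕ → Ω → V}

/-- If the centered sums of `f` have bounded expectations, then the expected time averages of `f`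
converge to its mean. -/
theorem tendsto_average_integral (hX : ∀ n v, MeasurableSet {ω | X n ω = v}) (f : V → ℝ) {C : ℝ}
    (hC : ∀ n, |∫ ω, ∑ t ∈ Finset.Icc 1 n, (f (X t ω) - degreeMean G f) ∂P| ≤ C) :
    Tendsto (fun n : ℕ => (1 / (n : ℝ)) * ∑ m ∈ Finset.Icc 1 n, ∫ ω, f (X m ω) ∂P)
      atTop (𝓝 (degreeMean G f)) := by
  rw [tendsto_iff_norm_sub_tendsto_zero]
  refine squeeze_zero' (Eventually.of_forall fun n => norm_nonneg _) ?_
    (tendsto_const_div_atTop_nhds_zero_nat C)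
  filter_upwards [eventually_gt_atTop 0] with n hn
  have hn' : (0 : ℝ) < n := by exact_mod_cast hn
  have h := hC n
  rw [integral_finsetSum (f := fun t ω => f (X t ω) - degreeMean G f) _ fun t _ =>
    (integrable_comp hX f t).sub (integrable_const _)] at h
  simp_rw [integral_sub (integrable_comp hX f _) (integrable_const (degreeMean G f))] at h
  simp only [integral_const, probReal_univ, one_smul, Finset.sum_sub_distrib, Finset.sum_const,
    Nat.card_Icc, add_tsub_cancel_right, nsmul_eq_mul] at h
  have hdiv : ∀ a c : ℝ, 1 / (n : ℝ) * a - c = (a - n * c) / n := fun a c => by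
    field_simp
  rw [Real.norm_eq_abs, hdiv, abs_div, abs_of_pos hn']
  gcongr

/-- The case of the indicator of `v`, whose degree mean is `π v`. -/
theorem hasStationaryDistribution_of_bounded [DecidableEq V]
    (hX : ∀ n v, MeasurableSet {ω | X n ω = v})
    (hC : ∀ f : V → ℝ, ∃ C, ∀ n,
      |∫ ω, ∑ t ∈ Finset.Icc 1 n, (f (X t ω) - degreeMean G f) ∂P| ≤ C) :
    HasStationaryDistribution P X
      (fun v => (G.degree v : ℝ) / (2 * (G.edgeFinset.card : ℝ))) := by
  intro v
  obtain ⟨C, hC⟩ := hC (fun w => if w = v then 1 else 0)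
  have h := tendsto_average_integral hX (fun w => if w = v then 1 else 0) hC
  convert h using 1
  · funext n
    congr 1
    refine Finset.sum_congr rfl fun m _ => ?_
    rw [← integral_indicator_one (hX m v)]
    refine integral_congr_ae (Eventually.of_forall fun ω => ?_)
    simp [Set.indicator_apply]
  · simp [degreeMean]

theorem mul_variance_meanEstimator (hX : ∀ n v, MeasurableSet {ω | X n ω = v}) (f : V → ℝ) (c : ℝ)
    (n : ℕ) : (n : ℝ) * variance (meanEstimator X f n) P =
      variance (fun ω => ∑ t ∈ Finset.Icc 1 n, (f (X t ω) - c)) P / n := by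
  rcases Nat.eq_zero_or_pos n with rfl | hn
  · simp
  have hn' : (n : ℝ) ≠ 0 := by positivity
  have hmeas : Measurable fun ω => ∑ t ∈ Finset.Icc 1 n, f (X t ω) :=
    Finset.measurable_sum _ fun t _ => measurable_comp_of_measurableSet_eq hX f t
  have h1 : variance (fun ω => ∑ t ∈ Finset.Icc 1 n, (f (X t ω) - c)) P =
      variance (fun ω => ∑ t ∈ Finset.Icc 1 n, f (X t ω)) P := by
    simp only [Finset.sum_sub_distrib]
    exact variance_sub_const hmeas.aestronglyMeasurable _
  rw [h1, show meanEstimator X f n =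
    fun ω => (1 / (n : ℝ)) * ∑ t ∈ Finset.Icc 1 n, f (X t ω) from rfl, variance_const_mul]
  field_simp

/-! ### Simple random walk -/

/-- The variance of `h` after one step of simple random walk. -/
noncomputable def srwVariance (G : SimpleGraph V) [DecidableRel G.Adj] (h : V → ℝ) (v : V) : ℝ :=
  ∑ w, srwProb G v w * (h w - srwAverage G h v) ^ 2

/-- Given the past, an increment has conditional mean zero: the martingale difference property. -/
theorem IsSRW.integral_sum_increments_mul (hX : IsSRW G P X) (hdeg : ∀ v, 0 < G.degree v)
    (h : V → ℝ) (n : ℕ) (F : (ℕ → V) → ℝ)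
    (hF : ∀ x y : ℕ → V, (∀ i ≤ n, x i = y i) → F x = F y) :
    ∫ ω, F (fun i => X i ω) * (h (X (n + 1) ω) - srwAverage G h (X n ω)) ∂P = 0 := by
  rw [hX.integral_mul_next n F hF (fun v w => h w - srwAverage G h v)]
  have : ∀ v, ∑ w, srwProb G v w * (h w - srwAverage G h v) = 0 := fun v => by
    simp only [mul_sub, Finset.sum_sub_distrib, ← Finset.sum_mul, sum_srwProb G v (hdeg v)]
    rw [one_mul, srwAverage, sub_self]
  simp [this]

theorem measurable_increment (hX : ∀ n v, MeasurableSet {ω | X n ω = v}) (h : V → ℝ) (t : ℕ) :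
    Measurable fun ω => h (X (t + 1) ω) - srwAverage G h (X t ω) :=
  (measurable_comp_of_measurableSet_eq hX h (t + 1)).sub
    (measurable_comp_of_measurableSet_eq hX (srwAverage G h) t)

theorem memLp_increment (hX : ∀ n v, MeasurableSet {ω | X n ω = v}) (h : V → ℝ) (t : ℕ) :
    MemLp (fun ω => h (X (t + 1) ω) - srwAverage G h (X t ω)) 2 P := by
  obtain ⟨C, hC⟩ := exists_forall_abs_le h
  obtain ⟨D, hD⟩ := exists_forall_abs_le (srwAverage G h)
  exact MemLp.of_bound (measurable_increment hX h t).aestronglyMeasurable (C + D)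
    (Eventually.of_forall fun ω => (norm_sub_le _ _).trans (add_le_add (hC _) (hD _)))

theorem memLp_sum_increments (hX : ∀ n v, MeasurableSet {ω | X n ω = v}) (h : V → ℝ) (n : ℕ) :
    MemLp (fun ω => ∑ t ∈ Finset.Icc 1 n, (h (X (t + 1) ω) - srwAverage G h (X t ω))) 2 P :=
  memLp_finsetSum _ fun t _ => memLp_increment hX h t

theorem IsSRW.integral_sum_increments (hX : IsSRW G P X) (hdeg : ∀ v, 0 < G.degree v)
    (h : V → ℝ) (n : ℕ) :
    ∫ ω, ∑ t ∈ Finset.Icc 1 n, (h (X (t + 1) ω) - srwAverage G h (X t ω)) ∂P = 0 := by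
  rw [integral_finsetSum _ fun t _ =>
    (memLp_increment hX.measurableSet_eq h t).integrable one_le_two]
  refine Finset.sum_eq_zero fun t _ => ?_
  simpa using hX.integral_sum_increments_mul hdeg h t (fun _ => 1) fun _ _ _ => rfl

theorem IsSRW.integral_sum_increments_sq (hX : IsSRW G P X) (hdeg : ∀ v, 0 < G.degree v)
    (h : V → ℝ) (n : ℕ) :
    ∫ ω, (∑ t ∈ Finset.Icc 1 n, (h (X (t + 1) ω) - srwAverage G h (X t ω))) ^ 2 ∂P =
      ∑ t ∈ Finset.Icc 1 n, ∫ ω, srwVariance G h (X t ω) ∂P := by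
  induction n with
  | zero => simp
  | succ n ih =>
    have hM := memLp_sum_increments (G := G) (P := P) hX.measurableSet_eq h n
    have hD := memLp_increment (G := G) (P := P) hX.measurableSet_eq h (n + 1)
    -- The earlier increments involve only times up to `n + 1`, so the cross term vanishes.
    have hcross := hX.integral_sum_increments_mul hdeg h (n + 1)
      (fun x => ∑ t ∈ Finset.Icc 1 n, (h (x (t + 1)) - srwAverage G h (x t)))
      (fun x y hxy => Finset.sum_congr rfl fun t ht => by
        rw [Finset.mem_Icc] at ht
        rw [hxy t (by omega), hxy (t + 1) (by omega)])
    have hsq := hX.integral_mul_next (n + 1) (fun _ => 1) (fun _ _ _ => rfl)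
      (fun v w => (h w - srwAverage G h v) ^ 2)
    simp only [one_mul] at hsq
    rw [Finset.sum_Icc_succ_top (by omega), ← ih]
    simp only [Finset.sum_Icc_succ_top (show 1 ≤ n + 1 by omega), add_sq, mul_assoc]
    have hMD : Integrable (fun ω =>
        (∑ t ∈ Finset.Icc 1 n, (h (X (t + 1) ω) - srwAverage G h (X t ω))) *
          (h (X (n + 1 + 1) ω) - srwAverage G h (X (n + 1) ω))) P := hM.integrable_mul hD
    rw [integral_add (f := fun ω => _ + 2 * _) (hM.integrable_sq.add (hMD.const_mul 2))
        hD.integrable_sq,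
      integral_add hM.integrable_sq (hMD.const_mul 2), integral_const_mul, hcross, hsq, mul_zero,
      add_zero]
    rfl

theorem IsSRW.exists_abs_integral_le [DecidableEq V] [Nontrivial V] (hG : G.Connected)
    (hX : IsSRW G P X)
    (f : V → ℝ) :
    ∃ C, ∀ n, |∫ ω, ∑ t ∈ Finset.Icc 1 n, (f (X t ω) - degreeMean G f) ∂P| ≤ C := by
  have hdeg : ∀ v, 0 < G.degree v := fun v => hG.preconnected.degree_pos_of_nontrivial v
  obtain ⟨h, hh⟩ := exists_sub_srwAverage_eq hG f
  obtain ⟨C, hC⟩ := exists_forall_abs_le h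
  refine ⟨C + C, fun n => ?_⟩
  have hb : Integrable (fun ω => h (X 1 ω) - h (X (n + 1) ω)) P :=
    (integrable_comp hX.measurableSet_eq h 1).sub (integrable_comp hX.measurableSet_eq h (n + 1))
  simp_rw [fun ω => sum_sub_degreeMean_eq hh (fun t => X t ω) n]
  rw [integral_add hb ((memLp_sum_increments hX.measurableSet_eq h n).integrable one_le_two),
    hX.integral_sum_increments hdeg, add_zero]
  have := norm_integral_le_of_norm_le_const (μ := P) (C := C + C)
    (f := fun ω => h (X 1 ω) - h (X (n + 1) ω)) (Eventually.of_forall fun ω =>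
      (norm_sub_le _ _).trans (add_le_add (hC _) (hC _)))
  simpa using this

/-- Weighted AM-GM, `2|bm| ≤ s b² + m²/s`, with `s` free to balance the two terms. -/
theorem abs_add_sq_sub_sq_le {b m C s : ℝ} (hb : |b| ≤ C) (hs : 0 < s) :
    |(b + m) ^ 2 - m ^ 2| ≤ C ^ 2 + s * C ^ 2 + m ^ 2 / s := by
  have hb2 : b ^ 2 ≤ C ^ 2 := sq_le_sq' (by linarith [(abs_le.1 hb).1]) (abs_le.1 hb).2
  have hsb : s * b ^ 2 ≤ s * C ^ 2 := mul_le_mul_of_nonneg_left hb2 hs.le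
  have h1 : 0 ≤ (s * b + m) ^ 2 / s := by positivity
  have h2 : 0 ≤ (s * b - m) ^ 2 / s := by positivity
  have e1 : (s * b + m) ^ 2 / s = s * b ^ 2 + 2 * b * m + m ^ 2 / s := by field_simp; ring
  have e2 : (s * b - m) ^ 2 / s = s * b ^ 2 - 2 * b * m + m ^ 2 / s := by field_simp; ring
  rw [e1] at h1
  rw [e2] at h2
  have hb0 : 0 ≤ b ^ 2 := sq_nonneg b
  rw [abs_le]
  constructor <;> nlinarith

theorem IsSRW.hasAsymptoticVariance [DecidableEq V] [Nontrivial V] (hG : G.Connected)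
    (hX : IsSRW G P X) {f h : V → ℝ} (hh : ∀ v, h v - srwAverage G h v = f v - degreeMean G f) :
    HasAsymptoticVariance P X f (degreeMean G (srwVariance G h)) := by
  have hdeg : ∀ v, 0 < G.degree v := fun v => hG.preconnected.degree_pos_of_nontrivial v
  obtain ⟨A, hA⟩ := hX.exists_abs_integral_le hG f
  obtain ⟨B, hB⟩ := hX.exists_abs_integral_le hG (srwVariance G h)
  obtain ⟨H, hH⟩ := exists_forall_abs_le h
  obtain ⟨K, hK⟩ := exists_forall_abs_le (srwVariance G h)
  have hlim := tendsto_average_integral hX.measurableSet_eq _ hB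
  set M : ℕ → Ω → ℝ := fun n ω =>
    ∑ t ∈ Finset.Icc 1 n, (h (X (t + 1) ω) - srwAverage G h (X t ω)) with hMdef
  set S : ℕ → Ω → ℝ := fun n ω => ∑ t ∈ Finset.Icc 1 n, (f (X t ω) - degreeMean G f) with hSdef
  have hMLp : ∀ n, MemLp (M n) 2 P := fun n => memLp_sum_increments hX.measurableSet_eq h n
  have hSM : ∀ n ω, S n ω = h (X 1 ω) - h (X (n + 1) ω) + M n ω := fun n ω =>
    sum_sub_degreeMean_eq hh (fun t => X t ω) n
  have hbd : ∀ n ω, |h (X 1 ω) - h (X (n + 1) ω)| ≤ H + H := fun n ω =>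
    (abs_sub _ _).trans (add_le_add (hH _) (hH _))
  have hSLp : ∀ n, MemLp (S n) 2 P := fun n => by
    have hb : MemLp (fun ω => h (X 1 ω) - h (X (n + 1) ω)) 2 P := MemLp.of_bound
      ((measurable_comp_of_measurableSet_eq hX.measurableSet_eq h 1).sub
        (measurable_comp_of_measurableSet_eq hX.measurableSet_eq h _)).aestronglyMeasurable
      (H + H) (Eventually.of_forall (hbd n))
    rw [show S n = (fun ω => h (X 1 ω) - h (X (n + 1) ω)) + M n from funext (hSM n)]
    exact hb.add (hMLp n)
  have hMsq : ∀ n, ∫ ω, M n ω ^ 2 ∂P = ∑ t ∈ Finset.Icc 1 n, ∫ ω, srwVariance G h (X t ω) ∂P :=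
    fun n => hX.integral_sum_increments_sq hdeg h n
  have hMle : ∀ n : ℕ, ∫ ω, M n ω ^ 2 ∂P ≤ n * K := by
    intro n
    rw [hMsq]
    calc ∑ t ∈ Finset.Icc 1 n, ∫ ω, srwVariance G h (X t ω) ∂P
        ≤ ∑ t ∈ Finset.Icc 1 n, K := Finset.sum_le_sum fun t _ => by
          refine (integral_mono (integrable_comp hX.measurableSet_eq _ t) (integrable_const K)
            fun ω => (le_abs_self _).trans (hK _)).trans ?_
          simp
      _ = n * K := by simp
  set C := H + H with hCdef
  -- As `E[M n ^ 2] ≤ n K`, taking `s = √n` makes the effect of the boundary term `O(√n)`,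
  -- negligible after division by `n`.
  have hdiff : ∀ n : ℕ, 0 < n → |variance (S n) P / n - (∫ ω, M n ω ^ 2 ∂P) / n| ≤
      (A ^ 2 + C ^ 2) / n + (C ^ 2 + K) / √n := by
    intro n hn
    have hn' : (0 : ℝ) < n := by exact_mod_cast hn
    have hs : 0 < √(n : ℝ) := Real.sqrt_pos.2 hn'
    have hss : √(n : ℝ) * √(n : ℝ) = n := Real.mul_self_sqrt hn'.le
    have hvar : variance (S n) P = ∫ ω, S n ω ^ 2 ∂P - (∫ ω, S n ω ∂P) ^ 2 := by
      rw [variance_eq_sub (hSLp n)]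
      rfl
    have h1 : |∫ ω, S n ω ^ 2 ∂P - ∫ ω, M n ω ^ 2 ∂P| ≤
        C ^ 2 + √n * C ^ 2 + (n * K) / √n := by
      rw [← integral_sub (hSLp n).integrable_sq (hMLp n).integrable_sq]
      calc |∫ ω, (S n ω ^ 2 - M n ω ^ 2) ∂P|
          ≤ ∫ ω, |S n ω ^ 2 - M n ω ^ 2| ∂P := abs_integral_le_integral_abs
        _ ≤ ∫ ω, (C ^ 2 + √n * C ^ 2 + M n ω ^ 2 / √n) ∂P := by
          refine integral_mono ((hSLp n).integrable_sq.sub (hMLp n).integrable_sq).abs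
            ((integrable_const _).add ((hMLp n).integrable_sq.div_const _)) fun ω => ?_
          simp only [hSM n ω]
          exact abs_add_sq_sub_sq_le (hbd n ω) hs
        _ = C ^ 2 + √n * C ^ 2 + (∫ ω, M n ω ^ 2 ∂P) / √n := by
          rw [integral_add (integrable_const _) ((hMLp n).integrable_sq.div_const _),
            integral_div]
          simp
        _ ≤ _ := by
          gcongr
          exact hMle n
    have h2 : (∫ ω, S n ω ∂P) ^ 2 ≤ A ^ 2 :=
      sq_le_sq' (by linarith [(abs_le.1 (hA n)).1]) (abs_le.1 (hA n)).2
    rw [← sub_div, abs_div, abs_of_pos hn', div_le_iff₀ hn', hvar]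
    have h3 : ((A ^ 2 + C ^ 2) / n + (C ^ 2 + K) / √n) * n =
        A ^ 2 + C ^ 2 + √n * C ^ 2 + (n * K) / √n := by
      have : (C ^ 2) / √n * n = √n * C ^ 2 := by
        rw [div_mul_eq_mul_div, div_eq_iff hs.ne']
        nlinarith
      rw [add_mul, div_mul_cancel₀ _ hn'.ne', add_div, add_mul, this]
      ring
    rw [h3]
    have h4 := sq_nonneg (∫ ω, S n ω ∂P)
    rw [abs_le] at h1 ⊢
    constructor <;> linarith [h1.1, h1.2]
  have hzero : Tendsto (fun n : ℕ => (A ^ 2 + C ^ 2) / (n : ℝ) + (C ^ 2 + K) / √(n : ℝ)) atTop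
      (𝓝 0) := by
    have hsqrt : Tendsto (fun n : ℕ => √(n : ℝ)) atTop atTop :=
      Real.tendsto_sqrt_atTop.comp tendsto_natCast_atTop_atTop
    simpa using (tendsto_const_div_atTop_nhds_zero_nat (A ^ 2 + C ^ 2)).add
      (hsqrt.const_div_atTop (C ^ 2 + K))
  have hd : Tendsto (fun n : ℕ => variance (S n) P / n - (∫ ω, M n ω ^ 2 ∂P) / n) atTop
      (𝓝 0) := by
    refine squeeze_zero_norm' ?_ hzero
    filter_upwards [eventually_gt_atTop 0] with n hn using hdiff n hn
  have hfin := hd.add hlim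
  rw [zero_add] at hfin
  refine hfin.congr fun n => ?_
  rw [mul_variance_meanEstimator hX.measurableSet_eq f (degreeMean G f) n, hMsq]
  ring

/-! ### GroupBy neighbors random walk -/

variable [DecidableEq V]

theorem GNRWMemory.along_congr (g : ∀ v, Finpartition (G.neighborFinset v)) {x y : ℕ → V} :
    ∀ k : ℕ, (∀ i ≤ k + 1, x i = y i) → along g x k = along g y k
  | 0, _ => rfl
  | k + 1, hxy => by
    rw [along, along, along_congr g k fun i hi => hxy i (by omega), hxy k (by omega),
      hxy (k + 1) (by omega), hxy (k + 2) (by omega)]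

/-- The sole fact about the transition law used later, the same for both weightings. -/
theorem GNRWMemory.notMem_attempted_of_nextProb_ne_zero {r : GroupWeight}
    {g : ∀ v, Finpartition (G.neighborFinset v)} {M : GNRWMemory V} {u v w : V}
    (hw : M.nextProb r g u v w ≠ 0) : w ∉ M.attempted u v := by
  obtain ⟨A, -, hne⟩ := Finset.exists_ne_zero_of_sum_ne_zero hw
  have hmem : w ∈ M.remaining u v A := by
    by_contra h
    simp [h] at hne
  exact (Finset.mem_sdiff.1 hmem).2

/-- Almost surely, each step of a GNRW goes to a neighbor not attempted before in the current
circulation. -/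
theorem IsGNRW.ae_step {r : GroupWeight} {g : ∀ v, Finpartition (G.neighborFinset v)}
    (hX : IsGNRW G r g P X) :
    ∀ᵐ ω ∂P, ∀ n, X (n + 2) ω ∉
      (GNRWMemory.along g (fun i => X i ω) n).attempted (X n ω) (X (n + 1) ω) := by
  rw [ae_all_iff]
  intro n
  refine ae_of_forall_prefix (n + 2) (fun x => x (n + 2) ∉
    (GNRWMemory.along g x n).attempted (x n) (x (n + 1))) ?_ ?_
  · intro x y hxy
    rw [GNRWMemory.along_congr g n fun i hi => hxy i (by omega), hxy n (by omega),
      hxy (n + 1) (by omega), hxy (n + 2) le_rfl]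
    exact id
  · intro x hx
    rw [show n + 2 = n + 1 + 1 from rfl, hX.transitions (n + 1) x (by omega), mul_eq_zero]
    right
    by_contra hne
    exact hx (GNRWMemory.notMem_attempted_of_nextProb_ne_zero hne)

/-- The increments of `h` over the complete circulations cancel. -/
theorem GNRWMemory.sum_increments_along (hdeg : ∀ v, 0 < G.degree v)
    (g : ∀ v, Finpartition (G.neighborFinset v)) (h : V → ℝ) {x : ℕ → V}
    (hx : ∀ n, x (n + 2) ∉ (along g x n).attempted (x n) (x (n + 1))) (n : ℕ) :
    ∑ t ∈ Finset.Icc 1 n, (h (x (t + 1)) - srwAverage G h (x t)) =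
      ∑ e : V × V, ∑ w ∈ (along g x n).attempted e.1 e.2, (h w - srwAverage G h e.2) := by
  induction n with
  | zero => simp [along, init]
  | succ n ih =>
    rw [Finset.sum_Icc_succ_top (by omega), ih,
      ← Finset.add_sum_erase _ _ (Finset.mem_univ (x n, x (n + 1))),
      ← Finset.add_sum_erase _ _ (Finset.mem_univ (x n, x (n + 1)))]
    have hrest : ∑ e ∈ Finset.univ.erase (x n, x (n + 1)),
        ∑ w ∈ (along g x (n + 1)).attempted e.1 e.2, (h w - srwAverage G h e.2) =
          ∑ e ∈ Finset.univ.erase (x n, x (n + 1)),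
            ∑ w ∈ (along g x n).attempted e.1 e.2, (h w - srwAverage G h e.2) := by
      refine Finset.sum_congr rfl fun e he => ?_
      have hne : ¬ (e.1 = x n ∧ e.2 = x (n + 1)) := fun h =>
        (Finset.mem_erase.1 he).1 (Prod.ext h.1 h.2)
      simp [along, update, hne]
    have hself : (along g x (n + 1)).attempted (x n) (x (n + 1)) =
        (along g x n).newAttempted G (x n) (x (n + 1)) (x (n + 2)) := by
      simp [along, update]
    -- Since the new node is not yet in `b(u,v)`, insertion adds exactly the new increment; if this
    -- completes the circulation, the total is zero and agrees with the reset to `∅`.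
    have hins := Finset.sum_insert (f := fun w => h w - srwAverage G h (x (n + 1))) (hx n)
    have hnew : ∑ w ∈ (along g x (n + 1)).attempted (x n) (x (n + 1)),
        (h w - srwAverage G h (x (n + 1))) =
        (h (x (n + 2)) - srwAverage G h (x (n + 1))) +
          ∑ w ∈ (along g x n).attempted (x n) (x (n + 1)),
            (h w - srwAverage G h (x (n + 1))) := by
      rw [hself, newAttempted, ← hins]
      split_ifs with hfull
      · rw [hfull, sum_neighborFinset_sub_srwAverage G h _ (hdeg _), Finset.sum_empty]
      · rfl
    rw [hrest, hnew]
    ring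

/-- The centered sums of a function along a GNRW are almost surely uniformly bounded. -/
theorem IsGNRW.exists_ae_abs_sum_le [Nontrivial V] (hG : G.Connected) {r : GroupWeight}
    {g : ∀ v, Finpartition (G.neighborFinset v)} (hX : IsGNRW G r g P X) (f : V → ℝ) :
    ∃ C, ∀ᵐ ω ∂P, ∀ n, |∑ t ∈ Finset.Icc 1 n, (f (X t ω) - degreeMean G f)| ≤ C := by
  have hdeg : ∀ v, 0 < G.degree v := fun v => hG.preconnected.degree_pos_of_nontrivial v
  obtain ⟨h, hh⟩ := exists_sub_srwAverage_eq hG f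
  obtain ⟨C, hC⟩ := exists_forall_abs_le h
  refine ⟨C + C + ∑ e : V × V, ∑ w, |h w - srwAverage G h e.2|, ?_⟩
  filter_upwards [hX.ae_step] with ω hω n
  rw [sum_sub_degreeMean_eq hh (fun t => X t ω) n,
    GNRWMemory.sum_increments_along hdeg g h hω n]
  refine (abs_add_le _ _).trans (add_le_add ((abs_sub _ _).trans (add_le_add (hC _) (hC _))) ?_)
  refine (Finset.abs_sum_le_sum_abs _ _).trans (Finset.sum_le_sum fun e _ => ?_)
  exact (Finset.abs_sum_le_sum_abs _ _).trans
    (Finset.sum_le_sum_of_subset_of_nonneg (Finset.subset_univ _) fun _ _ _ => abs_nonneg _)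

theorem IsGNRW.exists_abs_integral_le [Nontrivial V] (hG : G.Connected) {r : GroupWeight}
    {g : ∀ v, Finpartition (G.neighborFinset v)} (hX : IsGNRW G r g P X) (f : V → ℝ) :
    ∃ C, ∀ n, |∫ ω, ∑ t ∈ Finset.Icc 1 n, (f (X t ω) - degreeMean G f) ∂P| ≤ C := by
  obtain ⟨C, hC⟩ := hX.exists_ae_abs_sum_le hG f
  refine ⟨C, fun n => ?_⟩
  have := norm_integral_le_of_norm_le_const (μ := P) (C := C)
    (f := fun ω => ∑ t ∈ Finset.Icc 1 n, (f (X t ω) - degreeMean G f))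
    (hC.mono fun ω hω => hω n)
  simpa using this

/-- The asymptotic variance of a GNRW vanishes. -/
theorem IsGNRW.hasAsymptoticVariance [Nontrivial V] (hG : G.Connected) {r : GroupWeight}
    {g : ∀ v, Finpartition (G.neighborFinset v)} (hX : IsGNRW G r g P X) (f : V → ℝ) :
    HasAsymptoticVariance P X f 0 := by
  obtain ⟨C, hC⟩ := hX.exists_ae_abs_sum_le hG f
  refine squeeze_zero (fun n => mul_nonneg n.cast_nonneg (variance_nonneg _ _)) (fun n => ?_)
    (tendsto_const_div_atTop_nhds_zero_nat (C ^ 2))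
  rw [mul_variance_meanEstimator hX.measurableSet_eq f (degreeMean G f) n]
  have hmeas : Measurable fun ω => ∑ t ∈ Finset.Icc 1 n, (f (X t ω) - degreeMean G f) :=
    Finset.measurable_sum _ fun t _ =>
      (measurable_comp_of_measurableSet_eq hX.measurableSet_eq f t).sub_const _
  -- Values in `[-C, C]` have variance at most `C²`, uniformly in `n`.
  have := variance_le_sq_of_bounded (μ := P) (a := -C) (b := C)
    (hC.mono fun ω hω => abs_le.1 (hω n)) hmeas.aemeasurable
  rw [show (C - -C) / 2 = C by ring] at this
  gcongr

end Walks

theorem theorem4 {V : Type*} [Fintype V] [DecidableEq V] [Nontrivial V]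
    (G : SimpleGraph V) [DecidableRel G.Adj] (hG : G.Connected)
    (g : ∀ v, Finpartition (G.neighborFinset v)) (r : GroupWeight) :
    (∀ (Ω : Type*) [MeasurableSpace Ω] (P : Measure Ω) [IsProbabilityMeasure P] (X : ℕ → Ω → V),
      IsSRW G P X →
        HasStationaryDistribution P X
          (fun v => (G.degree v : ℝ) / (2 * (G.edgeFinset.card : ℝ)))) ∧
    (∀ (Ω : Type*) [MeasurableSpace Ω] (P : Measure Ω) [IsProbabilityMeasure P] (X : ℕ → Ω → V),
      IsGNRW G r g P X →
        HasStationaryDistribution P X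
          (fun v => (G.degree v : ℝ) / (2 * (G.edgeFinset.card : ℝ)))) ∧
    ∀ f : V → ℝ, ∃ σ σ' : ℝ,
      (∀ (Ω : Type*) [MeasurableSpace Ω] (P : Measure Ω) [IsProbabilityMeasure P]
        (X : ℕ → Ω → V), IsSRW G P X → HasAsymptoticVariance P X f σ) ∧
      (∀ (Ω : Type*) [MeasurableSpace Ω] (P : Measure Ω) [IsProbabilityMeasure P]
        (X : ℕ → Ω → V), IsGNRW G r g P X → HasAsymptoticVariance P X f σ') ∧
      σ' ≤ σ := by
  refine ⟨fun Ω _ P _ X hX => hasStationaryDistribution_of_bounded hX.measurableSet_eq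
      (hX.exists_abs_integral_le hG),
    fun Ω _ P _ X hX => hasStationaryDistribution_of_bounded hX.measurableSet_eq
      (hX.exists_abs_integral_le hG), fun f => ?_⟩
  obtain ⟨h, hh⟩ := exists_sub_srwAverage_eq hG f
  refine ⟨degreeMean G (srwVariance G h), 0,
    fun Ω _ P _ X hX => hX.hasAsymptoticVariance hG hh,
    fun Ω _ P _ X hX => hX.hasAsymptoticVariance hG f, ?_⟩
  -- With `σ' = 0`, the comparison is the nonnegativity of a mean of variances.
  exact Finset.sum_nonneg fun v _ => mul_nonneg (by positivity)
    (Finset.sum_nonneg fun w _ => mul_nonneg (srwProb_nonneg G v w) (sq_nonneg _))
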